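/- Let $D\subset\mathbb{C}^n$ be open, and let $A\subset D$ be an analytic subset of $D$, i.e. every point of $D$ has an open neighbourhood $U\subset D$ in which $A$ is the set of common zeros of finitely many holomorphic functions on $U$. Suppose that $A$ has codimension $k>0$, i.e. $k=n-\dim A$ with $\dim A$ the largest dimension of a nonempty complex submanifold contained in $A$ ($A$ need not be pure dimensional). Let $q\ge 0$, let $f=\sum_{|J|=q} f_J\,d\bar z_J$ be a $(0,q)$-form on $D$ with coefficients in $L^{2k/(2k-1)}_{loc}(D)$, and let $g=\sum_{|K|=q+1} g_K\,d\bar z_K$ be a $(0,q+1)$-form on $D$ with coefficients in $L^1_{loc}(D)$ (sums over strictly increasing multi-indices). If $\overline\partial f=g$ holds on $D\setminus A$ in the sense of distributions, then $\overline\partial f=g$ holds on all of $D$ in the sense of distributions. Here $\overline\partial f=g$ in the sense of distributions on an open set $\Omega$ means that, for every strictly increasing multi-index $K$ of length $q+1$ and every $\varphi\in C^\infty_c(\Omega)$, $$-\sum_{j\in K}\varepsilon(j,K)\int_\Omega f_{K\setminus j}\,\frac{\partial\varphi}{\partial\bar z_j}\,dV=\int_\Omega g_K\,\varphi\,dV,$$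 where $\varepsilon(j,K)=\pm1$ is defined by $d\bar z_j\wedge d\bar z_{K\setminus j}=\varepsilon(j,K)\,d\bar z_K$. -/

import Mathlib

open MeasureTheory
open scoped ENNReal ContDiff

namespace DbarExtension

/-- `A` is an analytic subset of the open set `D ⊆ ℂⁿ`: every point of `D` (not only of `A`) has
an open neighbourhood `U ⊆ D` in which `A` is the set of common zeros of finitely many
holomorphic functions on `U`. In particular `A` is closed in `D`. -/
def IsAnalyticSubset {n : ℕ} (A D : Set (Fin n → ℂ)) : Prop :=
  A ⊆ D ∧ ∀ p ∈ D, ∃ U : Set (Fin n → ℂ), IsOpen U ∧ p ∈ U ∧ U ⊆ D ∧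
    ∃ (m : ℕ) (h : Fin m → (Fin n → ℂ) → ℂ), (∀ i, DifferentiableOn ℂ (h i) U) ∧
      A ∩ U = {z ∈ U | ∀ i, h i z = 0}

/-- `M` is a (locally closed) complex submanifold of `ℂⁿ` of codimension `m`: near each of its
points it is the zero set of a holomorphic submersion to `ℂᵐ`. -/
def IsComplexSubmanifold {n : ℕ} (M : Set (Fin n → ℂ)) (m : ℕ) : Prop :=
  ∀ p ∈ M, ∃ U : Set (Fin n → ℂ), IsOpen U ∧ p ∈ U ∧
    ∃ h : (Fin n → ℂ) → (Fin m → ℂ), DifferentiableOn ℂ h U ∧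
      Function.Surjective (fderiv ℂ h p) ∧ M ∩ U = {z ∈ U | h z = 0}

/-- The codimension `n - dim A` of a set `A ⊆ ℂⁿ`, where, as in Łojasiewicz's textbook on complex
analytic geometry, `dim A` is the largest dimension of a nonempty complex submanifold contained
in `A`; hence `codim A` is the smallest codimension of such a submanifold. For an analytic set
this is `n` minus the largest dimension of `A` at its regular points; `A` need not be pure
dimensional. The codimension of the empty set is `⊤`. -/
noncomputable def codim {n : ℕ} (A : Set (Fin n → ℂ)) : ℕ∞ :=
  ⨅ (m : ℕ) (_ : ∃ M : Set (Fin n → ℂ), M ⊆ A ∧ M.Nonempty ∧ IsComplexSubmanifold M m), (m : ℕ∞)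

/-- Strictly increasing multi-indices `j₁ < ⋯ < j_q` in `{0, …, n-1}`, as `q`-element sets. -/
abbrev MultiIndex (n q : ℕ) : Type := {J : Finset (Fin n) // J.card = q}

/-- The multi-index `K` with one of its entries `j` left out. -/
def MultiIndex.erase {n q : ℕ} (K : MultiIndex n (q + 1)) (j : {j : Fin n // j ∈ K.1}) :
    MultiIndex n q :=
  ⟨K.1.erase j.1, by rw [Finset.card_erase_of_mem j.2, K.2]; rfl⟩

/-- The sign `ε` in `dz̄_j ∧ dz̄_{K ∖ j} = ε dz̄_K`, that is, `(-1)` to the number of entries of `K`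
that precede `j`. -/
def MultiIndex.sign {n q : ℕ} (K : MultiIndex n (q + 1)) (j : Fin n) : ℂ :=
  (-1) ^ (K.1.filter (· < j)).card

/-- `(0,q)`-forms `f = ∑_J f_J dz̄_J` on `ℂⁿ`, with `J` running through the strictly increasing
multi-indices of length `q`, given by the vector of their coefficients: `f z J` is `f_J(z)`.
The pointwise norm is `|f| = (∑_J |f_J|²)^{1/2}`. A form on a subset `D` is represented by
a form on `ℂⁿ` whose values outside of `D` are irrelevant. -/
abbrev Form (n q : ℕ) : Type := (Fin n → ℂ) → EuclideanSpace ℂ (MultiIndex n q)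

/-- `f ∈ L^p_{(0,q),loc}(D)`: `f` is measurable with `|f|` in `L^p(K)` for each compact
`K ⊆ D`, with respect to Lebesgue measure. -/
def LpLoc {n q : ℕ} (f : Form n q) (p : ℝ≥0∞) (D : Set (Fin n → ℂ)) : Prop :=
  ∀ K : Set (Fin n → ℂ), IsCompact K → K ⊆ D → MemLp f p (volume.restrict K)

/-- The Wirtinger derivative `∂φ/∂z̄_j = (∂φ/∂x_j + i ∂φ/∂y_j) / 2`. -/
noncomputable def dzbar {n : ℕ} (j : Fin n) (φ : (Fin n → ℂ) → ℂ) (z : Fin n → ℂ) : ℂ :=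
  (fderiv ℝ φ z (Pi.single j 1) + Complex.I * fderiv ℝ φ z (Pi.single j Complex.I)) / 2

/-- `φ ∈ C^∞_c(Ω)`. -/
def IsTestFunction {n : ℕ} (φ : (Fin n → ℂ) → ℂ) (Ω : Set (Fin n → ℂ)) : Prop :=
  ContDiff ℝ ∞ φ ∧ HasCompactSupport φ ∧ tsupport φ ⊆ Ω

/-- `∂̄f = g` on the open set `Ω` in the sense of distributions, for a `(0,q)`-form `f` and a
`(0,q+1)`-form `g` with locally integrable coefficients. Since
`∂̄f = ∑_J ∑_j ∂f_J/∂z̄_j dz̄_j ∧ dz̄_J`, this says that for each `K` the distribution `g_K` is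
equal to `∑_{j ∈ K} ε(j,K) ∂f_{K ∖ j}/∂z̄_j`, where distributional derivatives are defined by
`⟨∂u/∂z̄_j, φ⟩ = -∫ u ∂φ/∂z̄_j`. -/
def DbarEq {n q : ℕ} (f : Form n q) (g : Form n (q + 1)) (Ω : Set (Fin n → ℂ)) : Prop :=
  ∀ (K : MultiIndex n (q + 1)) (φ : (Fin n → ℂ) → ℂ), IsTestFunction φ Ω →
    ∑ j : {j : Fin n // j ∈ K.1}, K.sign j.1 * (-∫ z, f z (K.erase j) * dzbar j.1 φ z)
      = ∫ z, g z K * φ z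

end DbarExtension

/-! Let `E` be the set of points of `D` near which the equation fails. It lies in `A`, since `A` is
relatively closed in `D`. A partition of unity (`dbarEq_of_locally`) reduces the theorem to showing
that `E` is empty.

The geometry needs neither regular points nor a stratification of `A`. If `E` is nonempty, choose a
point `p` of `E` and holomorphic coordinates near `p` with as many coordinates vanishing on `E` as
possible, the maximum being over all points of `E`. By maximality, the functions vanishing on `E`
are stable under differentiation along the remaining coordinates: a nonzero derivative at a point of
`E` would supply one more vanishing coordinate there. All these derivatives vanish at `p`, so by
Taylor expansion such a function vanishes on the whole coordinate plane `M` through `p`. This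
applies to the local equations of `A`, so `M ⊆ A` near `p` and `M` has codimension at least `k`
(`exists_adaptedChart_card_ge`).

The analysis then only concerns the submanifold `M` (`dbarEq_of_diff_submanifold`). A test function
is multiplied by a cutoff vanishing near `M` and equal to `1` off its `ε`-tube. The cutoff has
gradient `O(1/ε)` and the tube has volume `O(ε ^ 2k)`; since `2k` is the exponent conjugate to
`2k/(2k-1)`, Hölder bounds the error by the `L^{2k/(2k-1)}` norm of `f` on the tube, which tends to
zero. Hence the equation holds near `p`, a contradiction. -/

namespace DbarExtension

/-! ### Holomorphic maps of several variables -/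

/-- Cauchy's estimate and integral formula for the derivative in the direction `v`. -/
theorem norm_fderiv_apply_le_of_closedBall {E : Type*} [NormedAddCommGroup E] [NormedSpace ℂ E]
    {h : E → ℂ} {z v : E} {R C : ℝ} (hR : 0 < R)
    (hd : ∀ y ∈ Metric.closedBall z R, DifferentiableAt ℂ h y)
    (hC : ∀ y ∈ Metric.closedBall z R, ‖h y‖ ≤ C) (hv : ‖v‖ ≤ 1) :
    ‖fderiv ℂ h z v‖ ≤ C / R ∧
      fderiv ℂ h z v =
        (2 * Real.pi * Complex.I : ℂ)⁻¹ • ∮ ζ in C(0, R), ((ζ - 0) ^ 2)⁻¹ • h (z + ζ • v) := by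
  have hmem : ∀ ζ : ℂ, ζ ∈ Metric.closedBall (0 : ℂ) R → z + ζ • v ∈ Metric.closedBall z R := by
    intro ζ hζ
    rw [mem_closedBall_zero_iff] at hζ
    rw [Metric.mem_closedBall, dist_eq_norm, add_sub_cancel_left, norm_smul]
    nlinarith [norm_nonneg ζ, norm_nonneg v]
  have hdiff : ∀ ζ ∈ Metric.closedBall (0 : ℂ) R,
      HasDerivAt (fun ζ : ℂ => h (z + ζ • v)) (fderiv ℂ h (z + ζ • v) v) ζ := by
    intro ζ hζ
    have h1 : HasDerivAt (fun ζ : ℂ => z + ζ • v) v ζ := by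
      simpa using ((hasDerivAt_id ζ).smul_const v).const_add z
    exact (hd _ (hmem ζ hζ)).hasFDerivAt.comp_hasDerivAt ζ h1
  have h0 : deriv (fun ζ : ℂ => h (z + ζ • v)) 0 = fderiv ℂ h z v := by
    simpa using (hdiff 0 (by simp [hR.le])).deriv
  have hdo : DifferentiableOn ℂ (fun ζ : ℂ => h (z + ζ • v)) (Metric.closedBall 0 R) :=
    fun ζ hζ => (hdiff ζ hζ).differentiableAt.differentiableWithinAt
  have hdc : DiffContOnCl ℂ (fun ζ : ℂ => h (z + ζ • v)) (Metric.ball 0 R) :=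
    hdo.diffContOnCl_ball subset_rfl
  constructor
  · rw [← h0]
    exact Complex.norm_deriv_le_of_forall_mem_sphere_norm_le hR hdc
      fun ζ hζ => hC _ (hmem ζ (Metric.sphere_subset_closedBall hζ))
  · rw [← h0]
    rw [← smul_right_injective ℂ Complex.two_pi_I_ne_zero |>.eq_iff, smul_smul,
      mul_inv_cancel₀ Complex.two_pi_I_ne_zero, one_smul]
    simpa using (hdc.deriv_eq_smul_circleIntegral hR).symm

/-- Cauchy's formula writes the directional derivative as an integral of `h` over a circle, and this
may be differentiated under the integral sign: Cauchy's estimate supplies the dominating constant.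
-/
theorem differentiableAt_fderiv_apply {n : ℕ} {h : (Fin n → ℂ) → ℂ} {U : Set (Fin n → ℂ)}
    (hU : IsOpen U) (hh : DifferentiableOn ℂ h U) {z₀ : Fin n → ℂ} (hz₀ : z₀ ∈ U)
    {v : Fin n → ℂ} (hv : ‖v‖ ≤ 1) :
    DifferentiableAt ℂ (fun z => fderiv ℂ h z v) z₀ := by
  obtain ⟨R', hR', hsub⟩ := Metric.isOpen_iff.1 hU z₀ hz₀
  -- Circles of radius `R` about points of the `R`-ball stay in the `2R`-ball; Cauchy's estimate
  -- there uses values of `h` on the `3R`-ball, which lies inside the domain.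
  obtain ⟨R, hR, rfl⟩ : ∃ R, 0 < R ∧ R' = 4 * R := ⟨R' / 4, by positivity, by ring⟩
  have hd : ∀ y ∈ Metric.closedBall z₀ (3 * R), DifferentiableAt ℂ h y := fun y hy =>
    hh.differentiableAt (hU.mem_nhds (hsub (Metric.closedBall_subset_ball (by linarith) hy)))
  obtain ⟨C, hC⟩ := (isCompact_closedBall z₀ (3 * R)).exists_bound_of_continuousOn
    (f := h) fun y hy => (hd y hy).continuousAt.continuousWithinAt
  have hC0 : 0 ≤ C := (norm_nonneg _).trans (hC z₀ (by simp [hR.le]))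
  have hball : ∀ z ∈ Metric.closedBall z₀ (2 * R),
      Metric.closedBall z R ⊆ Metric.closedBall z₀ (3 * R) := fun z hz =>
    Metric.closedBall_subset_closedBall' (by rw [Metric.mem_closedBall] at hz; linarith)
  have hbound : ∀ z ∈ Metric.closedBall z₀ (2 * R), ‖fderiv ℂ h z‖ ≤ C / R := by
    intro z hz
    refine ContinuousLinearMap.opNorm_le_of_unit_norm (by positivity) fun v hv => ?_
    exact (norm_fderiv_apply_le_of_closedBall hR (fun y hy => hd y (hball z hz hy))
      (fun y hy => hC y (hball z hz hy)) hv.le).1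
  have hcirc : ∀ z ∈ Metric.ball z₀ R, ∀ ζ ∈ Metric.sphere (0 : ℂ) R,
      z + ζ • v ∈ Metric.closedBall z₀ (2 * R) := by
    intro z hz ζ hζ
    rw [mem_sphere_zero_iff_norm] at hζ
    rw [Metric.mem_ball, dist_eq_norm] at hz
    rw [Metric.mem_closedBall, dist_eq_norm, add_sub_right_comm]
    refine (norm_add_le _ _).trans ?_
    rw [norm_smul, hζ]
    nlinarith
  have hderiv : ∀ z ∈ Metric.ball z₀ R, ∀ θ : ℝ,
      HasFDerivAt (fun z => h (z + circleMap 0 R θ • v))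
        (fderiv ℂ h (z + circleMap 0 R θ • v)) z := by
    intro z hz θ
    have hmem := hcirc z hz _ (circleMap_mem_sphere 0 hR.le θ)
    exact (hasFDerivAt_comp_add_right _).2
      (hd _ (Metric.closedBall_subset_closedBall (by linarith) hmem)).hasFDerivAt
  have hcoef : Continuous fun θ : ℝ => deriv (circleMap 0 R) θ * ((circleMap 0 R θ) ^ 2)⁻¹ := by
    simp only [deriv_circleMap]
    refine ((continuous_circleMap 0 R).mul continuous_const).mul
      (((continuous_circleMap 0 R).pow 2).inv₀ fun θ => pow_ne_zero 2 ?_)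
    simpa using circleMap_ne_center hR.ne' (c := 0) (θ := θ)
  have hcoefn : ∀ θ : ℝ, ‖deriv (circleMap 0 R) θ * ((circleMap 0 R θ) ^ 2)⁻¹‖ = R⁻¹ := by
    intro θ
    simp [deriv_circleMap, abs_of_pos hR]
    field_simp
  have hcont : ∀ z ∈ Metric.ball z₀ R, Continuous fun θ : ℝ => h (z + circleMap 0 R θ • v) := by
    intro z hz
    refine continuous_iff_continuousAt.2 fun θ => ?_
    have hmem := hcirc z hz _ (circleMap_mem_sphere 0 hR.le θ)
    exact ContinuousAt.comp (f := fun θ : ℝ => z + circleMap 0 R θ • v)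
      (hd _ (Metric.closedBall_subset_closedBall (by linarith) hmem)).continuousAt (by fun_prop)
  have key := intervalIntegral.hasFDerivAt_integral_of_dominated_of_fderiv_le
    (μ := volume) (a := 0) (b := 2 * Real.pi) (𝕜 := ℂ) (bound := fun _ => R⁻¹ * (C / R))
    (F := fun z θ => (deriv (circleMap 0 R) θ * ((circleMap 0 R θ) ^ 2)⁻¹) •
      h (z + circleMap 0 R θ • v))
    (F' := fun z θ => (deriv (circleMap 0 R) θ * ((circleMap 0 R θ) ^ 2)⁻¹) •
      fderiv ℂ h (z + circleMap 0 R θ • v))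
    (Metric.ball_mem_nhds z₀ hR)
    (by
      filter_upwards [Metric.ball_mem_nhds z₀ hR] with z hz
      exact (hcoef.smul (hcont z hz)).aestronglyMeasurable)
    ((hcoef.smul (hcont z₀ (Metric.mem_ball_self hR))).intervalIntegrable _ _)
    (by
      refine hcoef.aestronglyMeasurable.smul
        (Measurable.aestronglyMeasurable ((measurable_fderiv ℂ h).comp ?_))
      exact (Continuous.measurable (by fun_prop)))
    (by
      refine .of_forall fun θ _ z hz => ?_
      rw [norm_smul, hcoefn]
      gcongr
      exact hbound _ (hcirc z hz _ (circleMap_mem_sphere 0 hR.le θ)))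
    intervalIntegrable_const
    (.of_forall fun θ _ z hz => (hderiv z hz θ).fun_const_smul _)
  refine (key.differentiableAt.const_smul (2 * Real.pi * Complex.I : ℂ)⁻¹).congr_of_eventuallyEq ?_
  filter_upwards [Metric.ball_mem_nhds z₀ hR] with z hz
  have hz' : z ∈ Metric.closedBall z₀ (2 * R) :=
    Metric.closedBall_subset_closedBall (by linarith) (Metric.ball_subset_closedBall hz)
  rw [(norm_fderiv_apply_le_of_closedBall hR (fun y hy => hd y (hball z hz' hy))
      (fun y hy => hC y (hball z hz' hy)) hv).2]
  simp [circleIntegral, mul_assoc]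

/-- The Fréchet derivative of a holomorphic map of several variables is holomorphic. -/
theorem differentiableOn_fderiv {n m : ℕ} {h : (Fin n → ℂ) → (Fin m → ℂ)} {U : Set (Fin n → ℂ)}
    (hU : IsOpen U) (hh : DifferentiableOn ℂ h U) : DifferentiableOn ℂ (fderiv ℂ h) U := by
  intro z hz
  refine DifferentiableAt.differentiableWithinAt ?_
  have hsum : fderiv ℂ h = fun z => ∑ i, (ContinuousLinearMap.proj (R := ℂ)
      (φ := fun _ : Fin n => ℂ) i).smulRight (fderiv ℂ h z (Pi.single i 1)) := by
    ext z v j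
    conv_lhs => rw [pi_eq_sum_univ' v]
    simp [Finset.sum_apply]
  rw [hsum]
  refine DifferentiableAt.fun_sum fun i _ => ?_
  refine ((ContinuousLinearMap.smulRightL ℂ (Fin n → ℂ) (Fin m → ℂ)
    (ContinuousLinearMap.proj i)).differentiableAt).comp z ?_
  refine differentiableAt_pi.2 fun j => ?_
  have hj : DifferentiableOn ℂ (fun z => h z j) U := fun y hy =>
    (differentiableWithinAt_pi.1 (hh y hy)) j
  refine (differentiableAt_fderiv_apply hU hj hz (v := Pi.single i 1)
    ?_).congr_of_eventuallyEq ?_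
  · rw [Pi.norm_single, norm_one]
  · filter_upwards [hU.mem_nhds hz] with y hy
    rw [fderiv_apply ((hh y hy).differentiableAt (hU.mem_nhds hy)) j]
    rfl

theorem contDiffOn_of_differentiableOn {n m : ℕ} {h : (Fin n → ℂ) → (Fin m → ℂ)}
    {U : Set (Fin n → ℂ)} (hU : IsOpen U) (hh : DifferentiableOn ℂ h U) :
    ContDiffOn ℂ ∞ h U := by
  refine contDiffOn_infty.2 fun k => ?_
  induction k generalizing h with
  | zero => exact contDiffOn_zero.2 hh.continuousOn
  | succ k ih =>
    push_cast
    refine (contDiffOn_succ_iff_fderiv_of_isOpen hU).2 ⟨hh, by simp, ?_⟩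
    refine contDiffOn_clm_apply.2 fun v => ih ?_
    exact (differentiableOn_fderiv hU hh).clm_apply (differentiableOn_const v)

/-- A holomorphic function on a disc all of whose derivatives vanish at the centre is zero. -/
theorem eq_zero_of_hasDerivAt_seq {a : ℕ → ℂ → ℂ} {R : ℝ}
    (hd : ∀ m, ∀ t ∈ Metric.ball (0 : ℂ) R, HasDerivAt (a m) (a (m + 1) t) t)
    (h0 : ∀ m, a m 0 = 0) {t : ℂ} (ht : t ∈ Metric.ball (0 : ℂ) R) : a 0 t = 0 := by
  have hit : ∀ m, ∀ t ∈ Metric.ball (0 : ℂ) R, iteratedDeriv m (a 0) t = a m t := by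
    intro m
    induction m with
    | zero => simp
    | succ m ih =>
      intro t ht
      rw [iteratedDeriv_succ, ← (hd m t ht).deriv]
      refine Filter.EventuallyEq.deriv_eq ?_
      filter_upwards [Metric.isOpen_ball.mem_nhds ht] with s hs using ih s hs
  have hR : 0 < R := Metric.pos_of_mem_ball ht
  have hs := Complex.hasSum_taylorSeries_on_ball
    (f := a 0) (c := 0) (r := R) (fun s hs => (hd 0 s hs).differentiableAt.differentiableWithinAt) ht
  simp only [hit _ 0 (Metric.mem_ball_self hR), h0, smul_eq_mul, mul_zero] at hs
  exact hs.unique hasSum_zero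

/-! ### Coordinates adapted to a subset of an analytic set -/

/-- `F` is a holomorphic coordinate system on the neighbourhood `W` of `p`, and the coordinates
`F i` with `i ∈ S` vanish on `E ∩ W`. -/
structure AdaptedChart {n : ℕ} (E : Set (Fin n → ℂ)) (p : Fin n → ℂ) (S : Finset (Fin n))
    (F : (Fin n → ℂ) → (Fin n → ℂ)) (W : Set (Fin n → ℂ)) : Prop where
  isOpen : IsOpen W
  mem : p ∈ W
  differentiableOn : DifferentiableOn ℂ F W
  isUnit : IsUnit (fderiv ℂ F p)
  vanish : ∀ z ∈ E ∩ W, ∀ i ∈ S, F z i = 0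

theorem adaptedChart_empty {n : ℕ} (E : Set (Fin n → ℂ)) (p : Fin n → ℂ) :
    AdaptedChart E p ∅ id Set.univ where
  isOpen := isOpen_univ
  mem := Set.mem_univ p
  differentiableOn := differentiableOn_id
  isUnit := by
    rw [fderiv_id]
    exact isUnit_one
  vanish := by simp

theorem isUnit_of_injective {n : ℕ} {L : (Fin n → ℂ) →L[ℂ] (Fin n → ℂ)}
    (hL : Function.Injective L) : IsUnit L :=
  ContinuousLinearMap.isUnit_iff_bijective.2
    ⟨hL, LinearMap.injective_iff_surjective (f := L.toLinearMap).1 hL⟩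

/-- The derivative of `u` along the vector field with constant components `w` in the
coordinates `F`. -/
noncomputable def chartDeriv {n : ℕ} (F : (Fin n → ℂ) → (Fin n → ℂ)) (w : Fin n → ℂ)
    (u : (Fin n → ℂ) → ℂ) (z : Fin n → ℂ) : ℂ :=
  fderiv ℂ u z (Ring.inverse (fderiv ℂ F z) w)

theorem differentiableOn_chartDeriv {n : ℕ} {F : (Fin n → ℂ) → (Fin n → ℂ)}
    {W : Set (Fin n → ℂ)} (hW : IsOpen W) (hF : DifferentiableOn ℂ F W)
    (hu : ∀ z ∈ W, IsUnit (fderiv ℂ F z)) (w : Fin n → ℂ) {u : (Fin n → ℂ) → ℂ}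
    (hud : DifferentiableOn ℂ u W) : DifferentiableOn ℂ (chartDeriv F w u) W := by
  have hinv : DifferentiableOn ℂ (fun z => Ring.inverse (fderiv ℂ F z) w) W := by
    refine DifferentiableOn.clm_apply (fun z hz => ?_) (differentiableOn_const w)
    exact (differentiableAt_inverse (𝕜 := ℂ) (hu z hz)).comp_differentiableWithinAt z (differentiableOn_fderiv hW hF z hz)
  have hu' : DifferentiableOn ℂ (fun z => fderiv ℂ u z) W := by
    -- Scalars are viewed as vectors of length one so that `differentiableOn_fderiv` applies.
    let e : ℂ →L[ℂ] (Fin 1 → ℂ) := ContinuousLinearMap.pi fun _ => ContinuousLinearMap.id ℂ ℂ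
    have h1 := differentiableOn_fderiv hW (e.differentiable.comp_differentiableOn hud)
    have h2 : DifferentiableOn ℂ (fun z => (ContinuousLinearMap.proj (R := ℂ)
        (φ := fun _ : Fin 1 => ℂ) 0).comp (fderiv ℂ (e ∘ u) z)) W :=
      (ContinuousLinearMap.compL ℂ (Fin n → ℂ) (Fin 1 → ℂ) ℂ
        (ContinuousLinearMap.proj 0)).differentiable.comp_differentiableOn h1
    refine h2.congr fun z hz => ?_
    rw [(e.hasFDerivAt.comp z (hud.differentiableAt (hW.mem_nhds hz)).hasFDerivAt).fderiv]
    ext v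
    simp [e]
  exact hu'.clm_apply hinv

/-- A function vanishing on `E` may replace a coordinate along which its derivative is nonzero. -/
theorem AdaptedChart.update {n : ℕ} {E : Set (Fin n → ℂ)} {W : Set (Fin n → ℂ)}
    {S : Finset (Fin n)} {F : (Fin n → ℂ) → (Fin n → ℂ)} (hW : IsOpen W)
    (hF : DifferentiableOn ℂ F W) {p : Fin n → ℂ} (hp : p ∈ W)
    (hFu : IsUnit (fderiv ℂ F p)) (hv : ∀ z ∈ E ∩ W, ∀ i ∈ S, F z i = 0)
    {u : (Fin n → ℂ) → ℂ} (hud : DifferentiableOn ℂ u W) (hu : ∀ z ∈ E ∩ W, u z = 0)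
    {j : Fin n} (hj : chartDeriv F (Pi.single j 1) u p ≠ 0) :
    AdaptedChart E p (insert j S) (fun z => Function.update (F z) j (u z)) W where
  isOpen := hW
  mem := hp
  differentiableOn := by
    refine differentiableOn_pi.2 fun i => ?_
    by_cases hij : i = j
    · subst hij; simpa using hud
    · simpa [Function.update_of_ne hij] using differentiableOn_pi.1 hF i
  isUnit := by
    have hF' := hF.differentiableAt (hW.mem_nhds hp)
    have hu' := hud.differentiableAt (hW.mem_nhds hp)
    have hd : HasFDerivAt (fun z => Function.update (F z) j (u z))
        (ContinuousLinearMap.pi fun i => if i = j then fderiv ℂ u p else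
          (ContinuousLinearMap.proj i).comp (fderiv ℂ F p)) p := by
      refine hasFDerivAt_pi.2 fun i => ?_
      by_cases hij : i = j
      · subst hij; simpa using hu'.hasFDerivAt
      · simpa [Function.update_of_ne hij, hij] using hasFDerivAt_pi'.1 hF'.hasFDerivAt i
    rw [hd.fderiv]
    refine isUnit_of_injective ?_
    refine (injective_iff_map_eq_zero _).2 fun v hv0 => ?_
    -- For `v` in the kernel, all components of `dF v` except the `j`-th vanish, so `v` is a
    -- multiple of the `j`-th coordinate field; `du` is nonzero on that field, so the multiple is
    -- zero.
    have hcomp := congrFun hv0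
    have h1 : fderiv ℂ F p v = (fderiv ℂ F p v j) • Pi.single j 1 := by
      ext i
      by_cases hij : i = j
      · subst hij; simp
      · simpa [hij] using hcomp i
    have h2 : v = (fderiv ℂ F p v j) • Ring.inverse (fderiv ℂ F p) (Pi.single j 1) := by
      rw [← map_smul, ← h1, ← mul_apply_eq_comp, Ring.inverse_mul_cancel _ hFu,
        one_apply_eq_self]
    have h3 : fderiv ℂ u p v = 0 := by simpa using hcomp j
    rw [h2, map_smul, smul_eq_mul] at h3
    rcases mul_eq_zero.1 h3 with h4 | h4
    · rw [h2, h4, zero_smul]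
    · exact absurd h4 hj
  vanish := by
    intro z hz i hi
    by_cases hij : i = j
    · subst hij; simpa using hu z hz
    · simpa [Function.update_of_ne hij] using hv z hz i ((Finset.mem_insert.1 hi).resolve_left hij)

theorem chartDeriv_eq_sum {n : ℕ} (F : (Fin n → ℂ) → (Fin n → ℂ)) (w : Fin n → ℂ)
    (u : (Fin n → ℂ) → ℂ) (z : Fin n → ℂ) :
    chartDeriv F w u z = ∑ j, w j * chartDeriv F (Pi.single j 1) u z := by
  unfold chartDeriv
  conv_lhs => rw [pi_eq_sum_univ' w]
  simp only [map_sum, map_smul, smul_eq_mul]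

/-- If `F` is a holomorphic map with invertible derivative at `p`, it restricts to a
biholomorphic map near `p`. -/
theorem exists_openPartialHomeomorph {n : ℕ} {F : (Fin n → ℂ) → (Fin n → ℂ)}
    {W : Set (Fin n → ℂ)} (hW : IsOpen W) (hF : DifferentiableOn ℂ F W) {p : Fin n → ℂ}
    (hp : p ∈ W) (hFu : IsUnit (fderiv ℂ F p)) :
    ∃ Φ : OpenPartialHomeomorph (Fin n → ℂ) (Fin n → ℂ), (Φ : (Fin n → ℂ) → (Fin n → ℂ)) = F ∧
      p ∈ Φ.source ∧ Φ.source ⊆ W ∧ ∀ z ∈ Φ.source, IsUnit (fderiv ℂ F z) := by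
  have hcd : ContDiffAt ℂ 1 F p :=
    ((contDiffOn_of_differentiableOn hW hF).contDiffAt (hW.mem_nhds hp)).of_le (by simp)
  let e : (Fin n → ℂ) ≃L[ℂ] (Fin n → ℂ) := ContinuousLinearEquiv.ofUnit hFu.unit
  have he : HasFDerivAt F (e : (Fin n → ℂ) →L[ℂ] (Fin n → ℂ)) p := by
    have : (e : (Fin n → ℂ) →L[ℂ] (Fin n → ℂ)) = fderiv ℂ F p := by ext; rfl
    rw [this]
    exact (hF.differentiableAt (hW.mem_nhds hp)).hasFDerivAt
  let Φ := hcd.toOpenPartialHomeomorph F he (by simp)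
  have hcont : ContinuousOn (fderiv ℂ F) W := (differentiableOn_fderiv hW hF).continuousOn
  have hopen : IsOpen (W ∩ fderiv ℂ F ⁻¹' {L | IsUnit L}) :=
    hcont.isOpen_inter_preimage hW Units.isOpen
  refine ⟨Φ.restrOpen _ hopen, rfl, ?_, ?_, ?_⟩
  · exact ⟨hcd.mem_toOpenPartialHomeomorph_source he (by simp), hp, hFu⟩
  · exact fun z hz => hz.2.1
  · exact fun z hz => hz.2.2

/-- On a nonempty subset `E` of an analytic set `A`, there is a point at which the germ of `E` lies
in a submanifold of codimension at least `codim A`. -/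
theorem exists_adaptedChart_card_ge {n : ℕ} {A D E : Set (Fin n → ℂ)}
    (hA : IsAnalyticSubset A D) (hE : E ⊆ A) (hne : E.Nonempty) :
    ∃ p ∈ E, ∃ (S : Finset (Fin n)) (F : (Fin n → ℂ) → (Fin n → ℂ)) (W : Set (Fin n → ℂ)),
      AdaptedChart E p S F W ∧ codim A ≤ (S.card : ℕ∞) := by
  -- The maximum runs over all points of `E`, because the enlarged chart below is centred at an
  -- arbitrary point of `E` near `p`.
  obtain ⟨N, ⟨p, hpE, S, F, W, hc, hN⟩, hmax⟩ : ∃ N, (∃ p ∈ E, ∃ S F W,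
      AdaptedChart E p S F W ∧ S.card = N) ∧
      ∀ p ∈ E, ∀ S F W, AdaptedChart E p S F W → S.card ≤ N := by
    classical
    let P : ℕ → Prop := fun N => ∃ p ∈ E, ∃ S F W, AdaptedChart E p S F W ∧ S.card = N
    obtain ⟨p₀, hp₀⟩ := hne
    have h0 : P 0 := ⟨p₀, hp₀, ∅, id, Set.univ, adaptedChart_empty E p₀, rfl⟩
    refine ⟨Nat.findGreatest P n, Nat.findGreatest_spec (Nat.zero_le n) h0, ?_⟩
    intro p hp S F W h
    exact Nat.le_findGreatest (by simpa using S.card_le_univ) ⟨p, hp, S, F, W, h, rfl⟩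
  refine ⟨p, hpE, S, F, W, hc, ?_⟩
  obtain ⟨U, hU, hpU, -, m, h, hh, hAU⟩ := hA.2 p (hA.1 (hE hpE))
  obtain ⟨Φ, hΦF, hpΦ, hΦW, hΦu⟩ := exists_openPartialHomeomorph (hc.isOpen.inter hU)
    (hc.differentiableOn.mono Set.inter_subset_left) ⟨hc.mem, hpU⟩ hc.isUnit
  set W₀ := Φ.source with hW₀
  have hW₀o : IsOpen W₀ := Φ.open_source
  have hFd : DifferentiableOn ℂ F W₀ :=
    hc.differentiableOn.mono (hΦW.trans Set.inter_subset_left)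
  have hvan : ∀ z ∈ E ∩ W₀, ∀ i ∈ S, F z i = 0 :=
    fun z hz => hc.vanish z ⟨hz.1, (hΦW hz.2).1⟩
  -- Tangential derivatives preserve vanishing on `E`: otherwise `u` could replace a coordinate
  -- outside `S`, contradicting maximality.
  have hder : ∀ w : Fin n → ℂ, (∀ i ∈ S, w i = 0) → ∀ u : (Fin n → ℂ) → ℂ,
      DifferentiableOn ℂ u W₀ → (∀ z ∈ E ∩ W₀, u z = 0) →
      ∀ z ∈ E ∩ W₀, chartDeriv F w u z = 0 := by
    intro w hw u hud hu z hz
    rw [chartDeriv_eq_sum]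
    refine Finset.sum_eq_zero fun j _ => ?_
    by_cases hjS : j ∈ S
    · rw [hw j hjS, zero_mul]
    by_contra hne
    have hch := AdaptedChart.update hW₀o hFd hz.2 (hΦu z hz.2) hvan hud hu
      (j := j) (fun h0 => hne (by rw [h0, mul_zero]))
    have := hmax z hz.1 _ _ _ hch
    rw [Finset.card_insert_of_notMem hjS] at this
    omega
  -- Restricted to the complex line through `p` in direction `w`, `u` has all derivatives zero at
  -- `p`, so it vanishes along the disc; `1 < R` puts the endpoint `t = 1` inside.
  have hline : ∀ w : Fin n → ℂ, (∀ i ∈ S, w i = 0) → ∀ R : ℝ, 1 < R →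
      (∀ t ∈ Metric.ball (0 : ℂ) R, F p + t • w ∈ Φ.target) → ∀ u : (Fin n → ℂ) → ℂ,
      DifferentiableOn ℂ u W₀ → (∀ z ∈ E ∩ W₀, u z = 0) → u (Φ.symm (F p + w)) = 0 := by
    intro w hw R hR ht u hud hu
    have hiter : ∀ k, DifferentiableOn ℂ ((chartDeriv F w)^[k] u) W₀ ∧
        ∀ z ∈ E ∩ W₀, (chartDeriv F w)^[k] u z = 0 := by
      intro k
      induction k with
      | zero => exact ⟨hud, hu⟩
      | succ k ih =>
        rw [Function.iterate_succ_apply']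
        exact ⟨differentiableOn_chartDeriv hW₀o hFd hΦu w ih.1, hder w hw _ ih.1 ih.2⟩
    have := eq_zero_of_hasDerivAt_seq
      (a := fun k t => (chartDeriv F w)^[k] u (Φ.symm (F p + t • w))) (R := R) ?_ ?_
      (t := 1) (by simpa using hR)
    · simpa using this
    · intro k t htR
      have hz := Φ.map_target (ht t htR)
      obtain ⟨x, hx⟩ := hΦu _ hz
      have h1 : HasFDerivAt Φ ((ContinuousLinearEquiv.ofUnit x : _ ≃L[ℂ] _) :
          (Fin n → ℂ) →L[ℂ] (Fin n → ℂ)) (Φ.symm (F p + t • w)) := by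
        rw [hΦF]
        have : ((ContinuousLinearEquiv.ofUnit x : _ ≃L[ℂ] _) :
          (Fin n → ℂ) →L[ℂ] (Fin n → ℂ)) = fderiv ℂ F (Φ.symm (F p + t • w)) := by
          rw [← hx]; rfl
        rw [this]
        exact (hFd.differentiableAt (hW₀o.mem_nhds hz)).hasFDerivAt
      have h2 := Φ.hasFDerivAt_symm (ht t htR) h1
      have h3 : HasDerivAt (fun t : ℂ => F p + t • w) w t := by
        simpa using ((hasDerivAt_id t).smul_const w).const_add (F p)
      have h4 := h2.comp_hasDerivAt t h3
      have h5 := ((hiter k).1.differentiableAt (hW₀o.mem_nhds hz)).hasFDerivAt.comp_hasDerivAt t h4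
      rw [Function.iterate_succ_apply']
      refine h5.congr_deriv ?_
      unfold chartDeriv
      rw [← hx, Ring.inverse_unit]
      rfl
    · intro k
      have : Φ.symm (F p + (0 : ℂ) • w) = p := by
        rw [zero_smul, add_zero, ← hΦF]
        exact Φ.left_inv hpΦ
      simp only [this]
      exact (hiter k).2 p ⟨hpE, hpΦ⟩
  have hFpt : F p ∈ Φ.target := by rw [← hΦF]; exact Φ.map_source hpΦ
  obtain ⟨ρ, hρ, hball⟩ := Metric.isOpen_iff.1 Φ.open_target (F p) hFpt
  -- Shrinking to the preimage of a ball ensures that the disc from `F p` through each `F z` stays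
  -- in the range of the chart.
  let W₁ := W₀ ∩ F ⁻¹' Metric.ball (F p) ρ
  have hW₁ : IsOpen W₁ := hFd.continuousOn.isOpen_inter_preimage hW₀o Metric.isOpen_ball
  let M : Set (Fin n → ℂ) := {z ∈ W₁ | ∀ i ∈ S, F z i = 0}
  have hMA : M ⊆ A := by
    intro z hz
    have hzU : z ∈ U := (hΦW hz.1.1).2
    have hz0 : ∀ i, h i z = 0 := by
      intro i
      have hw : ‖F z - F p‖ < ρ := by rw [← dist_eq_norm]; exact hz.1.2
      obtain ⟨R, hR, hRw⟩ : ∃ R : ℝ, 1 < R ∧ R * ‖F z - F p‖ < ρ := by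
        rcases eq_or_lt_of_le (norm_nonneg (F z - F p)) with h0 | h0
        · exact ⟨2, one_lt_two, by rw [← h0]; simpa using hρ⟩
        · obtain ⟨R, h1, h2⟩ := exists_between ((one_lt_div h0).2 hw)
          exact ⟨R, h1, (lt_div_iff₀ h0).1 h2⟩
      have := hline (F z - F p)
        (fun i hi => by rw [Pi.sub_apply, hz.2 i hi, hvan p ⟨hpE, hpΦ⟩ i hi, sub_zero]) R hR
        (fun t ht => hball ?_) (h i)
        ((hh i).mono fun y hy => (hΦW hy).2) (fun y hy => ?_)
      · rw [add_sub_cancel, ← hΦF] at this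
        rwa [Φ.left_inv hz.1.1] at this
      · rw [mem_ball_zero_iff] at ht
        rw [Metric.mem_ball, dist_eq_norm, add_sub_cancel_left, norm_smul]
        refine lt_of_le_of_lt ?_ hRw
        gcongr
      · have : y ∈ A ∩ U := ⟨hE hy.1, (hΦW hy.2).2⟩
        rw [hAU] at this
        exact this.2 i
    have : z ∈ A ∩ U := by rw [hAU]; exact ⟨hzU, hz0⟩
    exact this.1
  have hpM : p ∈ M := ⟨⟨hpΦ, Metric.mem_ball_self hρ⟩, hvan p ⟨hpE, hpΦ⟩⟩
  refine iInf₂_le S.card ⟨M, hMA, ⟨p, hpM⟩, fun z hz => ?_⟩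
  let e : Fin S.card ≃ S := S.equivFin.symm
  let L : (Fin n → ℂ) →L[ℂ] (Fin S.card → ℂ) :=
    ContinuousLinearMap.pi fun i => ContinuousLinearMap.proj (e i : Fin n)
  have hLsurj : Function.Surjective L := by
    intro y
    refine ⟨fun j => if hj : j ∈ S then y (e.symm ⟨j, hj⟩) else 0, ?_⟩
    ext i
    simp [L]
  refine ⟨W₁, hW₁, hz.1, fun y => L (F y), ?_, ?_, ?_⟩
  · exact L.differentiable.comp_differentiableOn (hFd.mono Set.inter_subset_left)
  · have h1 : fderiv ℂ (fun y => L (F y)) z = L.comp (fderiv ℂ F z) :=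
      (L.hasFDerivAt.comp z (hFd.differentiableAt (hW₀o.mem_nhds hz.1.1)).hasFDerivAt).fderiv
    rw [h1]
    exact hLsurj.comp (ContinuousLinearMap.isUnit_iff_bijective.1 (hΦu z hz.1.1)).2
  · ext y
    constructor
    · intro hy
      refine ⟨hy.2, funext fun i => hy.1.2 _ (e i).2⟩
    · intro hy
      refine ⟨⟨hy.1, fun i hi => ?_⟩, hy.1⟩
      have := congrFun hy.2 (e.symm ⟨i, hi⟩)
      simpa [L] using this

/-! ### Calculus of the Wirtinger derivative -/

section Wirtinger

variable {n : ℕ} {φ ψ : (Fin n → ℂ) → ℂ} {z : Fin n → ℂ}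

theorem dzbar_eq_zero_of_eventuallyEq (j : Fin n) (h : φ =ᶠ[nhds z] fun _ => 0) :
    dzbar j φ z = 0 := by
  unfold dzbar
  rw [h.fderiv_eq]
  simp

theorem dzbar_eq_zero_of_notMem_tsupport (j : Fin n) (h : z ∉ tsupport φ) : dzbar j φ z = 0 :=
  dzbar_eq_zero_of_eventuallyEq j (notMem_tsupport_iff_eventuallyEq.1 h)

theorem tsupport_dzbar_subset (j : Fin n) (φ : (Fin n → ℂ) → ℂ) :
    tsupport (dzbar j φ) ⊆ tsupport φ :=
  closure_minimal (fun _ hz => by_contra fun h => hz (dzbar_eq_zero_of_notMem_tsupport j h))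
    (isClosed_tsupport φ)

theorem continuous_dzbar (j : Fin n) (hφ : ContDiff ℝ ∞ φ) : Continuous (dzbar j φ) := by
  have h := hφ.continuous_fderiv (by simp)
  unfold dzbar
  fun_prop

theorem dzbar_mul (j : Fin n) (hφ : DifferentiableAt ℝ φ z) (hψ : DifferentiableAt ℝ ψ z) :
    dzbar j (fun z => φ z * ψ z) z = φ z * dzbar j ψ z + ψ z * dzbar j φ z := by
  unfold dzbar
  rw [fderiv_fun_mul hφ hψ]
  simp
  ring

theorem dzbar_one_sub (j : Fin n) :
    dzbar j (fun z => 1 - φ z) z = -dzbar j φ z := by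
  unfold dzbar
  rw [fderiv_const_sub]
  simp
  ring

theorem dzbar_sum {ι : Type*} (s : Finset ι) (φ : ι → (Fin n → ℂ) → ℂ) (j : Fin n)
    (h : ∀ i ∈ s, DifferentiableAt ℝ (φ i) z) :
    dzbar j (fun z => ∑ i ∈ s, φ i z) z = ∑ i ∈ s, dzbar j (φ i) z := by
  unfold dzbar
  rw [fderiv_fun_sum h]
  simp [Finset.mul_sum, Finset.sum_add_distrib, ← Finset.sum_div]

theorem norm_dzbar_le (j : Fin n) : ‖dzbar j φ z‖ ≤ ‖fderiv ℝ φ z‖ := by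
  have h1 : ‖fderiv ℝ φ z (Pi.single j 1)‖ ≤ ‖fderiv ℝ φ z‖ := by
    simpa [Pi.norm_single] using (fderiv ℝ φ z).le_opNorm (Pi.single j 1)
  have h2 : ‖fderiv ℝ φ z (Pi.single j Complex.I)‖ ≤ ‖fderiv ℝ φ z‖ := by
    simpa [Pi.norm_single] using (fderiv ℝ φ z).le_opNorm (Pi.single j Complex.I)
  unfold dzbar
  rw [norm_div, Complex.norm_two, div_le_iff₀ two_pos]
  refine (norm_add_le _ _).trans ?_
  rw [norm_mul, Complex.norm_I, one_mul]
  linarith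

end Wirtinger

/-! ### Localization and limits of the distributional equation -/

section Distributions

variable {n q : ℕ} {D : Set (Fin n → ℂ)}

theorem LpLoc.integrable_mul {f : Form n q} {p : ℝ≥0∞} (hp : 1 ≤ p) (hf : LpLoc f p D)
    (J : MultiIndex n q) {ψ : (Fin n → ℂ) → ℂ} (hψ : Continuous ψ) (hc : HasCompactSupport ψ)
    (hs : tsupport ψ ⊆ D) : Integrable (fun z => f z J * ψ z) := by
  have hK : IsCompact (tsupport ψ) := hc
  have : IsFiniteMeasure (volume.restrict (tsupport ψ)) :=
    isFiniteMeasure_restrict.2 hK.measure_lt_top.ne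
  have h1 : Integrable f (volume.restrict (tsupport ψ)) := (hf _ hK hs).integrable hp
  have h2 : Integrable (fun z => f z J) (volume.restrict (tsupport ψ)) :=
    (EuclideanSpace.proj (𝕜 := ℂ) J).integrable_comp h1
  obtain ⟨C, hC⟩ := hc.exists_bound_of_continuous hψ
  have h3 : IntegrableOn (fun z => f z J * ψ z) (tsupport ψ) :=
    h2.mul_bdd hψ.aestronglyMeasurable (.of_forall hC)
  refine h3.integrable_of_forall_notMem_eq_zero fun z hz => ?_
  rw [image_eq_zero_of_notMem_tsupport hz, mul_zero]

theorem IsTestFunction.integrable_mul_dzbar {f : Form n q} {p : ℝ≥0∞} (hp : 1 ≤ p)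
    (hf : LpLoc f p D) (J : MultiIndex n q) (j : Fin n) {φ : (Fin n → ℂ) → ℂ}
    (hφ : IsTestFunction φ D) : Integrable (fun z => f z J * dzbar j φ z) :=
  hf.integrable_mul hp J (continuous_dzbar j hφ.1)
    (hφ.2.1.mono' ((subset_tsupport _).trans (tsupport_dzbar_subset j φ)))
    ((tsupport_dzbar_subset j φ).trans hφ.2.2)

theorem IsTestFunction.integrable_mul {f : Form n q} {p : ℝ≥0∞} (hp : 1 ≤ p)
    (hf : LpLoc f p D) (J : MultiIndex n q) {φ : (Fin n → ℂ) → ℂ}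
    (hφ : IsTestFunction φ D) : Integrable (fun z => f z J * φ z) :=
  hf.integrable_mul hp J hφ.1.continuous hφ.2.1 hφ.2.2

/-- The equation `∂̄f = g` in the sense of distributions is local. -/
theorem dbarEq_of_locally {f : Form n q} {g : Form n (q + 1)} {p : ℝ≥0∞} (hp : 1 ≤ p)
    (hf : LpLoc f p D) (hg : LpLoc g 1 D)
    (h : ∀ x ∈ D, ∃ U, IsOpen U ∧ x ∈ U ∧ DbarEq f g U) : DbarEq f g D := by
  intro K φ hφ
  choose! U hUo hxU hU using h
  obtain ⟨t, ht⟩ := (show IsCompact (tsupport φ) from hφ.2.1).elim_finite_subcover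
    (fun x : D => U x) (fun x => hUo x x.2)
    (fun x hx => Set.mem_iUnion.2 ⟨⟨x, hφ.2.2 hx⟩, hxU x (hφ.2.2 hx)⟩)
  -- The test function is split into pieces, each supported where the equation is known; both sides
  -- are additive in it.
  obtain ⟨ρ, hρ⟩ := SmoothPartitionOfUnity.exists_isSubordinate
    (modelWithCornersSelf ℝ (Fin n → ℂ)) (isClosed_tsupport φ)
    (fun x : t => U x) (fun x => hUo x x.1.2) (by
      intro x hx
      obtain ⟨i, hi, hxi⟩ := Set.mem_iUnion₂.1 (ht hx)
      exact Set.mem_iUnion.2 ⟨⟨i, hi⟩, hxi⟩)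
  let ψ : t → (Fin n → ℂ) → ℂ := fun i z => (ρ i z : ℂ) * φ z
  have hψts : ∀ i, tsupport (ψ i) ⊆ tsupport φ := fun i => tsupport_mul_subset_right
  have hψU : ∀ i, tsupport (ψ i) ⊆ U i := fun i => by
    refine (closure_mono fun z hz => ?_).trans (hρ i)
    intro h0
    exact hz (by simp [ψ, h0])
  have hψt : ∀ (i : t) (Ω : Set (Fin n → ℂ)), tsupport (ψ i) ⊆ Ω → IsTestFunction (ψ i) Ω := by
    intro i Ω hΩ
    refine ⟨?_, hφ.2.1.mono' ((subset_tsupport _).trans (hψts i)), hΩ⟩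
    have h1 : ContDiff ℝ ∞ (ρ i) := (ρ i).contMDiff.contDiff
    exact (Complex.ofRealCLM.contDiff.comp h1).mul hφ.1
  have hsum : φ = fun z => ∑ i, ψ i z := by
    ext z
    by_cases hz : z ∈ tsupport φ
    · have h1 := ρ.sum_eq_one hz
      rw [finsum_eq_sum_of_fintype] at h1
      simp only [ψ]
      rw [← Finset.sum_mul, ← Complex.ofReal_sum, h1, Complex.ofReal_one, one_mul]
    · simp [ψ, image_eq_zero_of_notMem_tsupport hz]
  have hD : ∀ i, IsTestFunction (ψ i) D := fun i => hψt i D ((hψts i).trans hφ.2.2)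
  have hl : ∀ j : {j : Fin n // j ∈ K.1}, ∫ z, f z (K.erase j) * dzbar j.1 φ z =
      ∑ i, ∫ z, f z (K.erase j) * dzbar j.1 (ψ i) z := by
    intro j
    rw [← integral_finsetSum _ fun i _ => (hD i).integrable_mul_dzbar hp hf _ _]
    congr 1
    ext z
    rw [← Finset.mul_sum, ← dzbar_sum _ _ _ fun i _ =>
      (hD i).1.contDiffAt.differentiableAt (by simp), ← hsum]
  have hr : ∫ z, g z K * φ z = ∑ i, ∫ z, g z K * ψ i z := by
    rw [← integral_finsetSum _ fun i _ => (hD i).integrable_mul le_rfl hg _]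
    congr 1
    ext z
    rw [← Finset.mul_sum, congrFun hsum z]
  rw [hr]
  simp only [hl, ← Finset.sum_neg_distrib, Finset.mul_sum]
  rw [Finset.sum_comm]
  exact Finset.sum_congr rfl fun i _ => hU i i.1.2 K (ψ i) (hψt i _ (hψU i))

/-- The error is at most `b N` times the integral of `|f|` over `s N`. It serves both sides of the
equation: `b N` is of order `1/ε` for the derivatives tested against `f`, and constant for `g`. -/
theorem tendsto_integral_mul {f : Form n q} {J : MultiIndex n q} {ψ : (Fin n → ℂ) → ℂ}
    {ψs : ℕ → (Fin n → ℂ) → ℂ} (hi : Integrable (fun z => f z J * ψ z))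
    (his : ∀ N, Integrable (fun z => f z J * ψs N z)) {s : ℕ → Set (Fin n → ℂ)}
    (hs : ∀ N, MeasurableSet (s N)) {b : ℕ → ℝ≥0∞} (hb : ∀ N, b N ≠ ⊤)
    (hle : ∀ N, ∀ z ∈ s N, ‖ψs N z - ψ z‖ₑ ≤ b N) (heq : ∀ N, ∀ z ∉ s N, ψs N z = ψ z)
    (ht : Filter.Tendsto (fun N => b N * ∫⁻ z in s N, ‖f z‖ₑ) Filter.atTop (nhds 0)) :
    Filter.Tendsto (fun N => ∫ z, f z J * ψs N z) Filter.atTop (nhds (∫ z, f z J * ψ z)) := by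
  rw [tendsto_iff_edist_tendsto_0]
  refine tendsto_of_tendsto_of_tendsto_of_le_of_le tendsto_const_nhds ht (fun _ => zero_le)
    fun N => ?_
  change edist _ _ ≤ _
  rw [edist_eq_enorm_sub, ← integral_sub (his N) hi]
  refine (enorm_integral_le_lintegral_enorm _).trans ?_
  rw [← lintegral_const_mul' _ _ (hb N), ← lintegral_indicator (hs N)]
  refine lintegral_mono fun z => ?_
  rw [← mul_sub, enorm_mul]
  by_cases hz : z ∈ s N
  · rw [Set.indicator_of_mem hz, mul_comm]
    refine mul_le_mul' (hle N z hz) ?_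
    rw [enorm_le_iff_norm_le]
    exact PiLp.norm_apply_le (f z) J
  · simp [heq N z hz]

/-- If the volume of the sets `s N` in a fixed compact set is `O(δ_N ^ 2k)`, then
`∫_{s N} |f| = o(δ_N)` for `f` in `L^{2k/(2k-1)}`. -/
theorem tendsto_inv_mul_setLIntegral {E : Type*} [NormedAddCommGroup E] {k : ℕ} (hk : 0 < k)
    {μ : Measure (Fin n → ℂ)} {f : (Fin n → ℂ) → E}
    (hf : MemLp f (ENNReal.ofReal (2 * (k : ℝ) / (2 * (k : ℝ) - 1))) μ)
    {s : ℕ → Set (Fin n → ℂ)} {δ : ℕ → ℝ≥0∞} (hδ0 : ∀ N, δ N ≠ 0) (hδt : ∀ N, δ N ≠ ⊤)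
    (hδ : Filter.Tendsto δ Filter.atTop (nhds 0)) {C : ℝ≥0∞} (hC : C ≠ ⊤)
    (hs : ∀ N, μ (s N) ≤ C * δ N ^ (2 * k)) :
    Filter.Tendsto (fun N => (δ N)⁻¹ * ∫⁻ z in s N, ‖f z‖ₑ ∂μ) Filter.atTop (nhds 0) := by
  have hk1 : (1 : ℝ) ≤ k := by exact_mod_cast hk
  set p : ℝ := 2 * (k : ℝ) / (2 * (k : ℝ) - 1) with hp
  have hp0 : 0 < p := div_pos (by linarith) (by linarith)
  have hpq : p.HolderConjugate (2 * k : ℝ) := by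
    rw [Real.holderConjugate_iff]
    refine ⟨by rw [hp, lt_div_iff₀ (by linarith)]; linarith, ?_⟩
    rw [hp]
    have : (2 * (k : ℝ) - 1) ≠ 0 := by linarith
    field_simp
    ring
  have hfin : ∫⁻ z, ‖f z‖ₑ ^ p ∂μ ≠ ⊤ := by
    have := (lintegral_rpow_enorm_lt_top_of_eLpNorm_lt_top (by simpa using hp0) (by simp) hf.2).ne
    rwa [ENNReal.toReal_ofReal hp0.le] at this
  have hμs : Filter.Tendsto (μ ∘ s) Filter.atTop (nhds 0) := by
    refine tendsto_of_tendsto_of_tendsto_of_le_of_le tendsto_const_nhds ?_ (fun _ => zero_le) hs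
    have h1 := ENNReal.Tendsto.const_mul (a := C) (ENNReal.Tendsto.pow (n := 2 * k) hδ) (Or.inr hC)
    rwa [zero_pow (by omega), mul_zero] at h1
  -- Absolute continuity of the integral improves the `O(δ)` from Hölder to `o(δ)`.
  have ht := tendsto_setLIntegral_zero hfin hμs
  have ht2 : Filter.Tendsto (fun N => C ^ (1 / (2 * k : ℝ)) *
      (∫⁻ z in s N, ‖f z‖ₑ ^ p ∂μ) ^ (1 / p)) Filter.atTop (nhds 0) := by
    have h1 := ENNReal.Tendsto.const_mul (a := C ^ (1 / (2 * k : ℝ)))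
      (ht.ennrpow_const (1 / p)) (Or.inr (ENNReal.rpow_ne_top_of_nonneg (by positivity) hC))
    rwa [ENNReal.zero_rpow_of_pos (by positivity), mul_zero] at h1
  refine tendsto_of_tendsto_of_tendsto_of_le_of_le tendsto_const_nhds ht2 (fun _ => zero_le)
    fun N => ?_
  have hH := ENNReal.lintegral_mul_le_Lp_mul_Lq (μ.restrict (s N)) hpq
    (f := fun z => ‖f z‖ₑ) (g := fun _ => 1) hf.1.restrict.enorm aemeasurable_const
  simp only [Pi.mul_apply, mul_one, ENNReal.one_rpow, lintegral_const, one_mul,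
    Measure.restrict_apply_univ] at hH
  have hvol : μ (s N) ^ (1 / (2 * k : ℝ)) ≤ C ^ (1 / (2 * k : ℝ)) * δ N := by
    refine (ENNReal.rpow_le_rpow (hs N) (by positivity)).trans_eq ?_
    rw [ENNReal.mul_rpow_of_nonneg _ _ (by positivity), ← ENNReal.rpow_natCast, ← ENNReal.rpow_mul]
    congr 1
    push_cast
    rw [mul_one_div_cancel (by positivity), ENNReal.rpow_one]
  calc (δ N)⁻¹ * ∫⁻ z in s N, ‖f z‖ₑ ∂μ
      ≤ (δ N)⁻¹ * ((∫⁻ z in s N, ‖f z‖ₑ ^ p ∂μ) ^ (1 / p) * (C ^ (1 / (2 * k : ℝ)) * δ N)) := by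
        gcongr
        exact hH.trans (by gcongr)
    _ = ((δ N)⁻¹ * δ N) * (C ^ (1 / (2 * k : ℝ)) * (∫⁻ z in s N, ‖f z‖ₑ ^ p ∂μ) ^ (1 / p)) := by
        ring
    _ = _ := by rw [ENNReal.inv_mul_cancel (hδ0 N) (hδt N), one_mul]

end Distributions

/-! ### Removing a submanifold by cutoffs -/

section Removability

variable {n q : ℕ}

theorem DbarEq.mono {f : Form n q} {g : Form n (q + 1)} {Ω Ω' : Set (Fin n → ℂ)}
    (h : DbarEq f g Ω) (hΩ : Ω' ⊆ Ω) : DbarEq f g Ω' :=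
  fun K φ hφ => h K φ ⟨hφ.1, hφ.2.1, hφ.2.2.trans hΩ⟩

theorem LpLoc.mono {f : Form n q} {p : ℝ≥0∞} {Ω Ω' : Set (Fin n → ℂ)}
    (h : LpLoc f p Ω) (hΩ : Ω' ⊆ Ω) : LpLoc f p Ω' :=
  fun K hK hKΩ => h K hK (hKΩ.trans hΩ)

/-- The volume of the `δ`-tube around the zero set of some of the holomorphic coordinates `F`. -/
theorem exists_volume_tube_le {F : (Fin n → ℂ) → (Fin n → ℂ)} {W : Set (Fin n → ℂ)}
    (hW : IsOpen W) (hF : DifferentiableOn ℂ F W) (hinj : Set.InjOn F W)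
    (hu : ∀ z ∈ W, IsUnit (fderiv ℂ F z)) {K : Set (Fin n → ℂ)} (hK : IsCompact K) (hKW : K ⊆ W)
    {S : Finset (Fin n)} {k : ℕ} (hk : k ≤ S.card) :
    ∃ C : ℝ≥0∞, C ≠ ⊤ ∧ ∀ δ : ℝ, 0 ≤ δ → δ ≤ 1 →
      volume {z ∈ K | ∀ i ∈ S, ‖F z i‖ ≤ δ} ≤ C * ENNReal.ofReal δ ^ (2 * k) := by
  have hdet0 : ∀ z ∈ K, 0 < |((fderiv ℂ F z).restrictScalars ℝ).det| := by
    intro z hz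
    rw [abs_pos]
    intro h0
    have h1 := LinearMap.bot_lt_ker_of_det_eq_zero h0
    have h2 := (ContinuousLinearMap.isUnit_iff_bijective.1 (hu z (hKW hz))).1
    exact h1.ne' (LinearMap.ker_eq_bot.2 h2)
  have hdetc : ContinuousOn (fun z => |((fderiv ℂ F z).restrictScalars ℝ).det|) K := by
    refine ContinuousOn.abs (ContinuousLinearMap.continuous_det.comp_continuousOn ?_)
    exact (ContinuousLinearMap.restrictScalarsL ℂ (Fin n → ℂ) (Fin n → ℂ) ℝ
      ℝ).continuous.comp_continuousOn ((differentiableOn_fderiv hW hF).continuousOn.mono hKW)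
  -- A positive lower bound for the real Jacobian on `K` lets the change of variables compare the
  -- tube with its image, which lies in a polydisc.
  obtain ⟨c, hc, hcK⟩ := hK.exists_forall_le' hdetc hdet0
  obtain ⟨R, hR⟩ := hK.exists_bound_of_continuousOn (hF.continuousOn.mono hKW)
  refine ⟨(ENNReal.ofReal c)⁻¹ * ∏ i : Fin n,
      ((if i ∈ S then 1 else ENNReal.ofReal R ^ 2) * NNReal.pi), ?_, fun δ hδ0 hδ1 => ?_⟩
  · refine ENNReal.mul_ne_top (ENNReal.inv_ne_top.2 (by simpa using hc))
      (ENNReal.prod_ne_top fun i _ => ENNReal.mul_ne_top ?_ ENNReal.coe_ne_top)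
    split_ifs <;> simp
  set s := {z ∈ K | ∀ i ∈ S, ‖F z i‖ ≤ δ} with hs
  have hscl : IsClosed s := by
    have : s = K ∩ F ⁻¹' {w | ∀ i ∈ S, ‖w i‖ ≤ δ} := rfl
    rw [this]
    refine (hF.continuousOn.mono hKW).preimage_isClosed_of_isClosed hK.isClosed ?_
    simp only [Set.ofPred_forall]
    exact isClosed_iInter fun i => isClosed_iInter fun _ =>
      isClosed_le (continuous_apply i).norm continuous_const
  have hsK : s ⊆ K := Set.sep_subset _ _
  have harea := lintegral_abs_det_fderiv_eq_addHaar_image volume hscl.measurableSet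
    (f := F) (f' := fun z => (fderiv ℂ F z).restrictScalars ℝ)
    (fun z hz => ((hF.differentiableAt
      (hW.mem_nhds (hKW (hsK hz)))).hasFDerivAt.restrictScalars ℝ).hasFDerivWithinAt)
    (hinj.mono (hsK.trans hKW))
  have hlow : ENNReal.ofReal c * volume s ≤ volume (F '' s) := by
    rw [← harea, ← setLIntegral_const]
    exact setLIntegral_mono' hscl.measurableSet fun z hz =>
      ENNReal.ofReal_le_ofReal (hcK z (hsK hz))
  have hbox : volume (F '' s) ≤ (∏ i : Fin n,
      ((if i ∈ S then 1 else ENNReal.ofReal R ^ 2) * NNReal.pi)) * ENNReal.ofReal δ ^ (2 * k) := by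
    have hsub : F '' s ⊆ Set.univ.pi fun i : Fin n =>
        Metric.closedBall (0 : ℂ) (if i ∈ S then δ else R) := by
      rintro _ ⟨z, hz, rfl⟩ i -
      rw [mem_closedBall_zero_iff]
      split_ifs with hi
      · exact hz.2 i hi
      · exact (norm_le_pi_norm _ i).trans (hR z (hsK hz))
    refine (measure_mono hsub).trans ?_
    rw [volume_pi_pi]
    simp only [Complex.volume_closedBall]
    have heq : ∀ i : Fin n, ENNReal.ofReal (if i ∈ S then δ else R) ^ 2 * (NNReal.pi : ℝ≥0∞) =
        (if i ∈ S then 1 else ENNReal.ofReal R ^ 2) * NNReal.pi *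
          (if i ∈ S then ENNReal.ofReal δ ^ 2 else 1) := by
      intro i
      split_ifs <;> ring
    rw [Finset.prod_congr rfl fun i _ => heq i, Finset.prod_mul_distrib]
    gcongr
    rw [Finset.prod_ite_mem, Finset.univ_inter, Finset.prod_const, ← pow_mul]
    -- The polydisc gives the power `2 * S.card`; `δ ≤ 1` allows lowering it to `2 * k`.
    exact pow_le_pow_right_of_le_one' (by simpa using hδ1) (by omega)
  rw [mul_assoc, ← ENNReal.mul_le_iff_le_inv (by simpa using hc) ENNReal.ofReal_ne_top]
  exact hlow.trans hbox

/-- Submanifolds of codimension at least `k` are removable for the equation `∂̄f = g` with `f` in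
`L^{2k/(2k-1)}`. -/
theorem dbarEq_of_diff_submanifold {f : Form n q} {g : Form n (q + 1)} {k : ℕ} (hk : 0 < k)
    {F : (Fin n → ℂ) → (Fin n → ℂ)} {W : Set (Fin n → ℂ)}
    (hW : IsOpen W) (hF : DifferentiableOn ℂ F W) (hinj : Set.InjOn F W)
    (hu : ∀ z ∈ W, IsUnit (fderiv ℂ F z)) {S : Finset (Fin n)} (hkS : k ≤ S.card)
    (hf : LpLoc f (ENNReal.ofReal (2 * (k : ℝ) / (2 * (k : ℝ) - 1))) W) (hg : LpLoc g 1 W)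
    (h : DbarEq f g (W \ {z | ∀ i ∈ S, F z i = 0})) : DbarEq f g W := by
  intro K φ hφ
  have hp : 1 ≤ ENNReal.ofReal (2 * (k : ℝ) / (2 * (k : ℝ) - 1)) := by
    have hk1 : (1 : ℝ) ≤ k := by exact_mod_cast hk
    rw [ENNReal.one_le_ofReal, le_div_iff₀ (by linarith)]
    linarith
  have hKc : IsCompact (tsupport φ) := hφ.2.1
  let b : ContDiffBump (0 : S → ℂ) := ⟨1 / 2, 1, by norm_num, by norm_num⟩
  let β : (S → ℂ) → ℂ := fun y => (b y : ℂ)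
  have hβ : ContDiff ℝ ∞ β := Complex.ofRealCLM.contDiff.comp b.contDiff
  have hβ1 : ∀ y, ‖y‖ ≤ 1 / 2 → β y = 1 := fun y hy => by
    simp only [β]
    rw [b.one_of_mem_closedBall (by simpa [b] using hy), Complex.ofReal_one]
  have hβ0 : ∀ y, 1 ≤ ‖y‖ → β y = 0 := fun y hy => by
    simp only [β]
    rw [b.zero_of_le_dist (by simpa [b] using hy), Complex.ofReal_zero]
  have hβn : ∀ y, ‖β y‖ ≤ 1 := fun y => by
    simp only [β]
    rw [Complex.norm_real, Real.norm_of_nonneg b.nonneg]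
    exact b.le_one
  have hβc : HasCompactSupport β :=
    HasCompactSupport.intro (isCompact_closedBall 0 1) fun y hy =>
      hβ0 y (by simpa using (not_le.1 (mt mem_closedBall_zero_iff.2 hy)).le)
  obtain ⟨Cβ, hCβ⟩ := (hβc.fderiv ℝ).exists_bound_of_continuous (hβ.continuous_fderiv (by simp))
  let G : (Fin n → ℂ) → (S → ℂ) := fun z i => F z i
  have hGs : ContDiffOn ℝ ∞ G W := by
    have h1 := (contDiffOn_of_differentiableOn hW hF).restrict_scalars ℝ
    exact contDiffOn_pi.2 fun i => contDiffOn_pi.1 h1 i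
  have hGc : ContinuousOn G W := hGs.continuousOn
  obtain ⟨CG, hCG⟩ := hKc.exists_bound_of_continuousOn
    ((hGs.continuousOn_fderiv_of_isOpen hW (by simp)).mono hφ.2.2)
  obtain ⟨Cφ, hCφ⟩ := hφ.2.1.exists_bound_of_continuous hφ.1.continuous
  obtain ⟨Cd, hCd⟩ := (hφ.2.1.fderiv ℝ).exists_bound_of_continuous
    (hφ.1.continuous_fderiv (by simp))
  have hCβ0 : 0 ≤ Cβ := (norm_nonneg _).trans (hCβ 0)
  have hCφ0 : 0 ≤ Cφ := (norm_nonneg _).trans (hCφ 0)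
  have hCd0 : 0 ≤ Cd := (norm_nonneg _).trans (hCd 0)
  obtain ⟨C, hC, hvol⟩ := exists_volume_tube_le hW hF hinj hu hKc hφ.2.2 hkS
  let ε : ℕ → ℝ := fun N => 1 / ((N : ℝ) + 1)
  have hε0 : ∀ N, 0 < ε N := fun N => Nat.one_div_pos_of_nat
  have hε1 : ∀ N, ε N ≤ 1 := fun N => by
    simp only [ε]
    rw [div_le_one (by positivity)]
    linarith [(Nat.cast_nonneg N : (0 : ℝ) ≤ N)]
  have hεt : Filter.Tendsto (fun N => ENNReal.ofReal (ε N)) Filter.atTop (nhds 0) := by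
    have := ENNReal.tendsto_ofReal (tendsto_one_div_add_atTop_nhds_zero_nat (𝕜 := ℝ))
    rwa [ENNReal.ofReal_zero] at this
  let χ : ℕ → (Fin n → ℂ) → ℂ := fun N z => β ((ε N)⁻¹ • G z)
  let ψ : ℕ → (Fin n → ℂ) → ℂ := fun N z => φ z * (1 - χ N z)
  let s : ℕ → Set (Fin n → ℂ) := fun N => {z ∈ tsupport φ | ∀ i ∈ S, ‖F z i‖ ≤ ε N}
  have hsG : ∀ N, s N = tsupport φ ∩ G ⁻¹' Metric.closedBall 0 (ε N) := by
    intro N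
    ext z
    simp only [s, Set.mem_ofPred_eq, Set.mem_inter_iff, Set.mem_preimage, mem_closedBall_zero_iff,
      pi_norm_le_iff_of_nonneg (hε0 N).le, G, Subtype.forall]
  have hsm : ∀ N, MeasurableSet (s N) := fun N => by
    rw [hsG]
    exact ((hGc.mono hφ.2.2).preimage_isClosed_of_isClosed (isClosed_tsupport φ)
      Metric.isClosed_closedBall).measurableSet
  have hssub : ∀ N, s N ⊆ tsupport φ := fun N => Set.sep_subset _ _
  have hχs : ∀ N, ∀ z ∈ W, ContDiffAt ℝ ∞ (χ N) z := fun N z hz =>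
    hβ.contDiffAt.comp z ((hGs.contDiffAt (hW.mem_nhds hz)).const_smul _)
  have hnorm : ∀ N z, ‖(ε N)⁻¹ • G z‖ = ‖G z‖ / ε N := fun N z => by
    rw [norm_smul, norm_inv, Real.norm_of_nonneg (hε0 N).le, div_eq_inv_mul]
  -- The cutoff `χ N` is controlled only on `W`; elsewhere smoothness of `ψ N` comes from its
  -- vanishing near every point outside the support of `φ`.
  have hψzero : ∀ N, ∀ z ∉ tsupport φ, ψ N =ᶠ[nhds z] fun _ => 0 := by
    intro N z hz
    filter_upwards [notMem_tsupport_iff_eventuallyEq.1 hz] with y hy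
    simp only [ψ, hy, Pi.zero_apply, zero_mul]
  have hψeq : ∀ N, ∀ z ∉ s N, ψ N =ᶠ[nhds z] φ := by
    intro N z hz
    by_cases hzs : z ∈ tsupport φ
    · have hzG : ε N < ‖G z‖ := by
        rw [hsG] at hz
        by_contra hle
        exact hz ⟨hzs, mem_closedBall_zero_iff.2 (not_lt.1 hle)⟩
      have hcont : ContinuousAt G z := hGc.continuousAt (hW.mem_nhds (hφ.2.2 hzs))
      filter_upwards [hcont.norm.eventually (lt_mem_nhds hzG)] with y hy
      simp only [ψ, χ]
      rw [hβ0 _ (by rw [hnorm, one_le_div (hε0 N)]; exact hy.le), sub_zero, mul_one]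
    · exact (hψzero N z hzs).trans (notMem_tsupport_iff_eventuallyEq.1 hzs).symm
  have hψsupp : ∀ N, tsupport (ψ N) ⊆ tsupport φ := fun N z hz =>
    by_contra fun hz' => (notMem_tsupport_iff_eventuallyEq.2 (hψzero N z hz')) hz
  have hψt : ∀ N, IsTestFunction (ψ N) (W \ {z | ∀ i ∈ S, F z i = 0}) := by
    intro N
    refine ⟨contDiff_iff_contDiffAt.2 fun z => ?_,
      hφ.2.1.mono' ((subset_tsupport _).trans (hψsupp N)), fun z hz => ⟨hφ.2.2 (hψsupp N hz), ?_⟩⟩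
    · by_cases hz : z ∈ tsupport φ
      · exact hφ.1.contDiffAt.mul (contDiffAt_const.sub (hχs N z (hφ.2.2 hz)))
      · exact contDiffAt_const.congr_of_eventuallyEq (hψzero N z hz)
    · intro hM
      have hzW := hφ.2.2 (hψsupp N hz)
      have hGz : ‖G z‖ < ε N / 2 := by
        have : G z = 0 := funext fun i => hM i i.2
        rw [this, norm_zero]
        exact half_pos (hε0 N)
      refine notMem_tsupport_iff_eventuallyEq.2 ?_ hz
      filter_upwards [(hGc.continuousAt (hW.mem_nhds hzW)).norm.eventually (gt_mem_nhds hGz)]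
        with y hy
      simp only [ψ, χ]
      rw [hβ1 _ (by rw [hnorm, div_le_iff₀ (hε0 N)]; linarith), sub_self, mul_zero, Pi.zero_apply]
  have hψW : ∀ N, IsTestFunction (ψ N) W := fun N =>
    ⟨(hψt N).1, (hψt N).2.1, (hψt N).2.2.trans Set.sdiff_subset⟩
  have hψφ : ∀ N z, ‖ψ N z - φ z‖ ≤ Cφ := by
    intro N z
    have : ψ N z - φ z = -(φ z * χ N z) := by simp only [ψ]; ring
    rw [this, norm_neg, norm_mul]
    exact (mul_le_of_le_one_right (norm_nonneg _) (hβn _)).trans (hCφ z)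
  have hdχ : ∀ N j, ∀ z ∈ tsupport φ, ‖dzbar j (χ N) z‖ ≤ Cβ * (CG * (ε N)⁻¹) := by
    intro N j z hz
    refine (norm_dzbar_le j).trans ?_
    have hG' := ((hGs.contDiffAt (hW.mem_nhds (hφ.2.2 hz))).differentiableAt
      (by simp)).hasFDerivAt.const_smul (ε N)⁻¹
    have hβ' := (hβ.contDiffAt (x := (ε N)⁻¹ • G z)).differentiableAt (by simp)
    have hχ' : HasFDerivAt (χ N) _ z := hβ'.hasFDerivAt.comp z hG'
    rw [hχ'.fderiv]
    refine (ContinuousLinearMap.opNorm_comp_le _ _).trans ?_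
    have hε := hε0 N
    rw [norm_smul, norm_inv, Real.norm_of_nonneg hε.le, mul_comm _ ‖fderiv ℝ G z‖]
    gcongr
    · exact hCβ _
    · exact hCG z hz
  have hdψφ : ∀ N j, ∀ z ∈ s N,
      ‖dzbar j (ψ N) z - dzbar j φ z‖ ≤ (Cd + Cφ * (Cβ * CG)) * (ε N)⁻¹ := by
    intro N j z hz
    have hz' := hssub N hz
    have hχd : DifferentiableAt ℝ (χ N) z :=
      (hχs N z (hφ.2.2 hz')).differentiableAt (by simp)
    have h1 : dzbar j (ψ N) z - dzbar j φ z =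
        -(χ N z * dzbar j φ z + φ z * dzbar j (χ N) z) := by
      simp only [ψ]
      rw [dzbar_mul j (hφ.1.contDiffAt.differentiableAt (by simp))
        ((differentiableAt_const (1 : ℂ)).fun_sub hχd), dzbar_one_sub]
      ring
    rw [h1, norm_neg]
    refine (norm_add_le _ _).trans ?_
    rw [norm_mul, norm_mul]
    have h2 : ‖χ N z‖ * ‖dzbar j φ z‖ ≤ Cd :=
      (mul_le_of_le_one_left (norm_nonneg _) (hβn _)).trans ((norm_dzbar_le j).trans (hCd z))
    have h3 : ‖φ z‖ * ‖dzbar j (χ N) z‖ ≤ Cφ * (Cβ * (CG * (ε N)⁻¹)) :=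
      mul_le_mul (hCφ z) (hdχ N j z hz') (norm_nonneg _) hCφ0
    have h4 : Cd ≤ Cd * (ε N)⁻¹ := le_mul_of_one_le_right hCd0 ((one_le_inv₀ (hε0 N)).2 (hε1 N))
    linarith
  have hfl : Filter.Tendsto (fun N => (ENNReal.ofReal (ε N))⁻¹ * ∫⁻ z in s N, ‖f z‖ₑ)
      Filter.atTop (nhds 0) := by
    have := tendsto_inv_mul_setLIntegral hk (hf _ hKc hφ.2.2) (s := s)
      (δ := fun N => ENNReal.ofReal (ε N)) (fun N => by simpa using hε0 N)
      (fun N => ENNReal.ofReal_ne_top) hεt hC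
      (fun N => (Measure.restrict_apply_le _ _).trans (hvol (ε N) (hε0 N).le (hε1 N)))
    simpa only [Measure.restrict_restrict_of_subset (hssub _)] using this
  have hgl : Filter.Tendsto (fun N => ∫⁻ z in s N, ‖g z‖ₑ) Filter.atTop (nhds 0) := by
    have hfin : ∫⁻ z in tsupport φ, ‖g z‖ₑ ≠ ⊤ :=
      (memLp_one_iff_integrable.1 (hg _ hKc hφ.2.2)).2.ne
    have hv : Filter.Tendsto (volume.restrict (tsupport φ) ∘ s) Filter.atTop (nhds 0) := by
      have h1 := ENNReal.Tendsto.const_mul (a := C) (ENNReal.Tendsto.pow (n := 2 * k) hεt)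
        (Or.inr hC)
      rw [zero_pow (by omega), mul_zero] at h1
      exact tendsto_of_tendsto_of_tendsto_of_le_of_le tendsto_const_nhds h1 (fun _ => zero_le)
        fun N => (Measure.restrict_apply_le _ _).trans (hvol (ε N) (hε0 N).le (hε1 N))
    simpa only [Measure.restrict_restrict_of_subset (hssub _)] using
      tendsto_setLIntegral_zero hfin hv
  have hL : ∀ j : {j : Fin n // j ∈ K.1}, Filter.Tendsto
      (fun N => ∫ z, f z (K.erase j) * dzbar j.1 (ψ N) z) Filter.atTop
      (nhds (∫ z, f z (K.erase j) * dzbar j.1 φ z)) := by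
    intro j
    refine tendsto_integral_mul (hφ.integrable_mul_dzbar hp hf _ _)
      (fun N => (hψW N).integrable_mul_dzbar hp hf _ _) hsm
      (b := fun N => ENNReal.ofReal (Cd + Cφ * (Cβ * CG)) * (ENNReal.ofReal (ε N))⁻¹)
      (fun N => ENNReal.mul_ne_top ENNReal.ofReal_ne_top
        (ENNReal.inv_ne_top.2 (by simpa using hε0 N))) (fun N z hz => ?_) (fun N z hz => ?_) ?_
    · rw [← ofReal_norm, ← ENNReal.ofReal_inv_of_pos (hε0 N),
        ← ENNReal.ofReal_mul' (inv_nonneg.2 (hε0 N).le)]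
      exact ENNReal.ofReal_le_ofReal (hdψφ N j z hz)
    · unfold dzbar
      rw [(hψeq N z hz).fderiv_eq]
    · have := ENNReal.Tendsto.const_mul (a := ENNReal.ofReal (Cd + Cφ * (Cβ * CG))) hfl
        (Or.inr ENNReal.ofReal_ne_top)
      simpa only [mul_zero, mul_assoc] using this
  have hR : Filter.Tendsto (fun N => ∫ z, g z K * ψ N z) Filter.atTop
      (nhds (∫ z, g z K * φ z)) := by
    refine tendsto_integral_mul (hφ.integrable_mul le_rfl hg _)
      (fun N => (hψW N).integrable_mul le_rfl hg _) hsm (b := fun _ => ENNReal.ofReal Cφ)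
      (fun N => ENNReal.ofReal_ne_top) (fun N z _ => ?_) (fun N z hz => (hψeq N z hz).self_of_nhds)
      ?_
    · rw [← ofReal_norm]
      exact ENNReal.ofReal_le_ofReal (hψφ N z)
    · have := ENNReal.Tendsto.const_mul (a := ENNReal.ofReal Cφ) hgl
        (Or.inr ENNReal.ofReal_ne_top)
      simpa only [mul_zero] using this
  -- Each `ψ N` is supported off the submanifold, so the equation holds for it exactly and passes to
  -- the limit.
  refine tendsto_nhds_unique
    (tendsto_finsetSum _ fun j _ => ((hL j).neg.const_mul (K.sign j.1))) ?_
  refine hR.congr fun N => ?_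
  exact (h K (ψ N) (hψt N)).symm

/-- Local equations exist at every point of `D`, so off `A` one of them is nonzero, and remains so
nearby. -/
theorem IsAnalyticSubset.exists_isOpen_subset_diff {A D : Set (Fin n → ℂ)}
    (hA : IsAnalyticSubset A D) {p : Fin n → ℂ} (hp : p ∈ D \ A) :
    ∃ V, IsOpen V ∧ p ∈ V ∧ V ⊆ D \ A := by
  obtain ⟨U, hU, hpU, hUD, m, h, hh, hAU⟩ := hA.2 p hp.1
  have hnot : ¬ ∀ i, h i p = 0 := fun h0 => by
    have : p ∈ A ∩ U := by rw [hAU]; exact ⟨hpU, h0⟩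
    exact hp.2 this.1
  obtain ⟨i, hi⟩ := not_forall.1 hnot
  refine ⟨U ∩ h i ⁻¹' {0}ᶜ, (hh i).continuousOn.isOpen_inter_preimage hU
    isOpen_compl_singleton, ⟨hpU, hi⟩, fun z hz => ⟨hUD hz.1, fun hzA => ?_⟩⟩
  have : z ∈ A ∩ U := ⟨hzA, hz.1⟩
  rw [hAU] at this
  exact hz.2 (this.2 i)

end Removability

end DbarExtension

/-! ### The extension theorem -/

theorem theorem3p2 (n q k : ℕ) (hk : 0 < k) (D A : Set (Fin n → ℂ)) (hD : IsOpen D)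
    (hA : DbarExtension.IsAnalyticSubset A D) (hcodim : DbarExtension.codim A = (k : ℕ∞))
    (f : DbarExtension.Form n q) (g : DbarExtension.Form n (q + 1))
    (hf : DbarExtension.LpLoc f (ENNReal.ofReal (2 * (k : ℝ) / (2 * (k : ℝ) - 1))) D)
    (hg : DbarExtension.LpLoc g 1 D)
    (hfg : DbarExtension.DbarEq f g (D \ A)) :
    DbarExtension.DbarEq f g D := by
  have hp : 1 ≤ ENNReal.ofReal (2 * (k : ℝ) / (2 * (k : ℝ) - 1)) := by
    have hk1 : (1 : ℝ) ≤ k := by exact_mod_cast hk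
    rw [ENNReal.one_le_ofReal, le_div_iff₀ (by linarith)]
    linarith
  let E : Set (Fin n → ℂ) :=
    {p ∈ D | ¬ ∃ U, IsOpen U ∧ p ∈ U ∧ DbarExtension.DbarEq f g U}
  have hEA : E ⊆ A := by
    intro p hpE
    by_contra hpA
    obtain ⟨V, hV, hpV, hVs⟩ := hA.exists_isOpen_subset_diff ⟨hpE.1, hpA⟩
    exact hpE.2 ⟨V, hV, hpV, hfg.mono hVs⟩
  rcases E.eq_empty_or_nonempty with hE | hE
  · refine DbarExtension.dbarEq_of_locally hp hf hg fun x hx => ?_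
    by_contra hno
    exact (hE ▸ (⟨hx, hno⟩ : x ∈ E) : x ∈ (∅ : Set (Fin n → ℂ)))
  obtain ⟨p, hpE, S, F, W, hc, hS⟩ := DbarExtension.exists_adaptedChart_card_ge hA hEA hE
  rw [hcodim, Nat.cast_le] at hS
  obtain ⟨Φ, hΦF, hpΦ, hΦW, hΦu⟩ := DbarExtension.exists_openPartialHomeomorph
    (hc.isOpen.inter hD) (hc.differentiableOn.mono Set.inter_subset_left) ⟨hc.mem, hpE.1⟩ hc.isUnit
  have hΦD : Φ.source ⊆ D := hΦW.trans Set.inter_subset_right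
  refine absurd ⟨Φ.source, Φ.open_source, hpΦ, ?_⟩ hpE.2
  refine DbarExtension.dbarEq_of_diff_submanifold hk Φ.open_source
    (hc.differentiableOn.mono (hΦW.trans Set.inter_subset_left)) (hΦF ▸ Φ.injOn) hΦu hS
    (hf.mono hΦD) (hg.mono hΦD) ?_
  -- Points of the chart off the submanifold are not in `E`, so the equation holds near each of them
  -- and can be glued.
  refine DbarExtension.dbarEq_of_locally hp (hf.mono (Set.sdiff_subset.trans hΦD))
    (hg.mono (Set.sdiff_subset.trans hΦD)) fun x hx => ?_
  by_contra hno
  exact hx.2 (hc.vanish x ⟨⟨hΦD hx.1, hno⟩, (hΦW hx.1).1⟩)
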